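/- Let $n \ge 2$. Let $\mathbb H$ be the quaternions, let $\mathrm{Sp}(n)=\{A\in M_n(\mathbb H): A^*A=AA^*=I\}$, and let $\mathrm{PSp}(n)=\mathrm{Sp}(n)/\{\pm I\}$ with the quotient topology. Call a pair $(g_1,g_2)$ of elements of a group $G$ strongly doubly reversible if there is $h\in G$ with $h^2=1$, $hg_1h^{-1}=g_1^{-1}$ and $hg_2h^{-1}=g_2^{-1}$. Then the set of strongly doubly reversible pairs in $\mathrm{PSp}(n)$ has Haar measure zero in $\mathrm{PSp}(n)\times\mathrm{PSp}(n)$. -/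

import Mathlib

open scoped Quaternion Matrix

namespace QuaternionicUnitary

/-- The compact symplectic group `Sp(n)`: quaternionic `n × n` matrices `A` with
`A* A = A A* = I`, where `A*` is the conjugate transpose. It carries the topology induced
from the entrywise topology on matrices. -/
abbrev Sp (n : ℕ) : Type := unitary (Matrix (Fin n) (Fin n) ℍ)

/-- The subgroup `{I, -I}` of `Sp(n)`. -/
def plusMinusOne (n : ℕ) : Subgroup (Sp n) where
  carrier := {A | A = 1 ∨ A = -1}
  one_mem' := Or.inl rfl
  mul_mem' := by
    rintro a b (rfl | rfl) (rfl | rfl) <;> simp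
  inv_mem' := by
    rintro a (rfl | rfl)
    · simp
    · right
      rw [inv_eq_iff_mul_eq_one]
      simp

instance plusMinusOne_normal (n : ℕ) : (plusMinusOne n).Normal where
  conj_mem := by
    rintro a (rfl | rfl) g
    · left
      simp
    · right
      simp

/-- The projective group `PSp(n) = Sp(n) / {±I}`. -/
def PSp (n : ℕ) : Type := Sp n ⧸ plusMinusOne n

noncomputable instance (n : ℕ) : Group (PSp n) :=
  inferInstanceAs (Group (Sp n ⧸ plusMinusOne n))

/-- `PSp(n)` carries the quotient topology. -/
instance (n : ℕ) : TopologicalSpace (PSp n) :=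
  inferInstanceAs (TopologicalSpace (Sp n ⧸ plusMinusOne n))

/-- `PSp(n)` carries its Borel σ-algebra. -/
instance (n : ℕ) : MeasurableSpace (PSp n) := borel (PSp n)

instance (n : ℕ) : BorelSpace (PSp n) := ⟨rfl⟩

instance (n : ℕ) : IsTopologicalGroup (PSp n) :=
  inferInstanceAs (IsTopologicalGroup (Sp n ⧸ plusMinusOne n))

/-- `PSp(n)` is second countable, so the product σ-algebra on `PSp(n) × PSp(n)` is the Borel
σ-algebra of the product topology. -/
instance (n : ℕ) : SecondCountableTopology (PSp n) := by
  have : SecondCountableTopology ℍ :=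
    Quaternion.linearIsometryEquivTuple.toHomeomorph.secondCountableTopology
  have : SecondCountableTopology (Matrix (Fin n) (Fin n) ℍ) :=
    inferInstanceAs (SecondCountableTopology (Fin n → Fin n → ℍ))
  have : SecondCountableTopology (Sp n) :=
    TopologicalSpace.secondCountableTopology_induced _ (Matrix (Fin n) (Fin n) ℍ) Subtype.val
  exact (QuotientGroup.isQuotientMap_mk (N := plusMinusOne n)).secondCountableTopology
    QuotientGroup.isOpenMap_coe

/-- A pair `(g₁, g₂)` in a group is strongly doubly reversible if some `h` with `h² = 1`
simultaneously conjugates `(g₁, g₂)` to `(g₁⁻¹, g₂⁻¹)`. -/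
def IsStronglyDoublyReversible {G : Type*} [Group G] (g : G × G) : Prop :=
  ∃ h : G, h ^ 2 = 1 ∧ h * g.1 * h⁻¹ = g.1⁻¹ ∧ h * g.2 * h⁻¹ = g.2⁻¹

end QuaternionicUnitary

/-!
A strongly doubly reversible pair has the form `(x * y, x * z)` with `x ^ 2 = y ^ 2 = z ^ 2 = 1`,
and the solutions of `x ^ 2 = 1` in `PSp(n)` lift to projective involutions of `Sp(n)`. Near a
projective involution `h`, the commutator `y ↦ h * y - y * h` embeds the projective involutions
bi-Lipschitzly into the space of skew-adjoint matrices anticommuting with `h`; the trace of the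
projection onto this space shows that its dimension is at most `n * (n + 1)`. Hence the strongly
doubly reversible pairs lift to a set of Hausdorff dimension at most `3 * n * (n + 1)`, which is
less than `dim (Sp(n) × Sp(n)) = 2 * n * (2 * n + 1)` when `n ≥ 2`. To pass from dimension to
measure, push Lebesgue measure on the Lie algebra forward by the exponential map: a set all of
whose right translates are null for such a measure is Haar null, by Fubini.
-/

open MeasureTheory Set Filter Topology Module
open scoped NNReal ENNReal

theorem dimH_le_of_forall_exists_mem_nhdsWithin {X : Type*} [EMetricSpace X]
    [SecondCountableTopology X] {s : Set X} {r : ℝ≥0∞}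
    (h : ∀ x ∈ s, ∃ t ∈ 𝓝[s] x, dimH t ≤ r) : dimH s ≤ r := by
  by_contra! hlt
  obtain ⟨x, hx, hx'⟩ := exists_mem_nhdsWithin_lt_dimH_of_lt_dimH hlt
  obtain ⟨t, ht, hle⟩ := h x hx
  exact (hx' t ht).not_ge hle

theorem dimH_le_dimH_image_of_antilipschitzWith_domRestrict {X Y : Type*} [EMetricSpace X]
    [EMetricSpace Y] {s : Set X} {f : X → Y} {K : ℝ≥0}
    (h : AntilipschitzWith K (s.domRestrict f)) : dimH s ≤ dimH (f '' s) :=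
  calc dimH s = dimH (univ : Set s) := by
        rw [← (isometry_subtype_coe (s := s)).dimH_image, image_univ, Subtype.range_coe]
    _ ≤ dimH (s.domRestrict f '' univ) := h.le_dimH_image _
    _ = dimH (f '' s) := by rw [image_univ, range_domRestrict]

theorem dimH_submodule {E : Type*} [NormedAddCommGroup E] [NormedSpace ℝ E] (W : Submodule ℝ E)
    [FiniteDimensional ℝ W] : dimH (W : Set E) = finrank ℝ W := by
  rw [← Real.dimH_univ_eq_finrank W, ← W.subtypeₗᵢ.isometry.dimH_image]
  simp

theorem exists_mem_nhds_forall_dimH_le_dimH_image {E F : Type*} [NormedAddCommGroup E]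
    [NormedSpace ℝ E] [NormedAddCommGroup F] [NormedSpace ℝ F] {f : E → F} {f' : E ≃L[ℝ] F} {a : E}
    (hf : HasStrictFDerivAt f (f' : E →L[ℝ] F) a) :
    ∃ U ∈ 𝓝 a, ∀ s ⊆ U, dimH s ≤ dimH (f '' s) := by
  obtain ⟨U, haU, hU, hfU⟩ := hf.approximates_deriv_on_open_nhds
  exact ⟨U, hU.mem_nhds haU, fun s hs => dimH_le_dimH_image_of_antilipschitzWith_domRestrict
    ((hfU.mono_set hs).antilipschitz
      (f'.subsingleton_or_nnnorm_symm_pos.imp_right fun hpos =>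
        NNReal.half_lt_self (inv_pos.2 hpos).ne'))⟩

theorem finrank_submodule_prod {K V W : Type*} [DivisionRing K] [AddCommGroup V] [Module K V]
    [FiniteDimensional K V] [AddCommGroup W] [Module K W] [FiniteDimensional K W]
    (p : Submodule K V) (q : Submodule K W) :
    finrank K (p.prod q) = finrank K p + finrank K q := by
  have hrange : LinearMap.range (p.subtype.prodMap q.subtype) = p.prod q := by
    rw [LinearMap.range_prodMap, p.range_subtype, q.range_subtype]
  rw [← hrange, LinearMap.finrank_range_of_inj
    (p.subtype_injective.prodMap q.subtype_injective), finrank_prod]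

section StarAlgebra

variable {R S : Type*} [Ring R] [StarRing R] [Ring S] [StarRing S]

/-- The unitary elements whose square is central of order at most two, that is, the unitary
elements which become involutions modulo central involutions. -/
def projectiveInvolutions (R : Type*) [Ring R] [StarRing R] : Set R :=
  {x | x ∈ unitary R ∧ x ^ 2 ∈ center R ∧ x ^ 4 = 1}

theorem star_eq_pow_three_of_mem_projectiveInvolutions {x : R}
    (hx : x ∈ projectiveInvolutions R) : star x = x ^ 3 :=
  calc star x = star x * x ^ 4 := by rw [hx.2.2, mul_one]
    _ = star x * x * x ^ 3 := by rw [mul_assoc, ← pow_succ']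
    _ = x ^ 3 := by rw [Unitary.star_mul_self_of_mem hx.1, one_mul]

theorem mk_mem_projectiveInvolutions_iff {x : R} {y : S} :
    (x, y) ∈ projectiveInvolutions (R × S) ↔
      x ∈ projectiveInvolutions R ∧ y ∈ projectiveInvolutions S := by
  simp only [projectiveInvolutions, mem_ofPred_eq, Unitary.mem_iff, Set.center_prod, Prod.mul_def,
    Prod.pow_def, Prod.star_def, Prod.mk_eq_one, mem_prod]
  tauto

variable [Algebra ℝ R] [StarModule ℝ R] [Algebra ℝ S] [StarModule ℝ S]

/-- The skew-adjoint elements anticommuting with `h`. For `h` a projective involution, this is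
the tangent space at `h` of the set of projective involutions, translated to the identity. -/
def skewAnticommutant (h : R) : Submodule ℝ R :=
  skewAdjoint.submodule ℝ R ⊓ LinearMap.ker (LinearMap.mulLeft ℝ h + LinearMap.mulRight ℝ h)

theorem mem_skewAnticommutant_iff {h x : R} :
    x ∈ skewAnticommutant h ↔ star x = -x ∧ h * x = -(x * h) := by
  rw [← add_eq_zero_iff_eq_neg (a := h * x)]
  rfl

theorem commutator_mem_skewAnticommutant {h y : R} (hh : h ∈ projectiveInvolutions R)
    (hy : y ∈ projectiveInvolutions R) (hyh : y ^ 2 = h ^ 2) :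
    h * y - y * h ∈ skewAnticommutant h := by
  have hstar : star y * star h = y * h :=
    calc star y * star h = y * (y ^ 2 * h ^ 2) * h := by
          rw [star_eq_pow_three_of_mem_projectiveInvolutions hh,
            star_eq_pow_three_of_mem_projectiveInvolutions hy]
          noncomm_ring
      _ = y * h := by rw [hyh, ← pow_add, hh.2.2, mul_one]
  have hstar' : star h * star y = h * y := by
    simpa only [star_mul, star_star] using (congrArg star hstar).symm
  have hcomm : h ^ 2 * y = y * h ^ 2 := hh.2.1.comm y
  refine mem_skewAnticommutant_iff.2 ⟨?_, ?_⟩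
  · rw [star_sub, star_mul, star_mul, hstar, hstar', neg_sub]
  · calc h * (h * y - y * h) = h ^ 2 * y - h * y * h := by noncomm_ring
      _ = y * h ^ 2 - h * y * h := by rw [hcomm]
      _ = -((h * y - y * h) * h) := by noncomm_ring

theorem finrank_skewAdjoint_prod [FiniteDimensional ℝ R] [FiniteDimensional ℝ S] :
    finrank ℝ (skewAdjoint.submodule ℝ (R × S)) =
      finrank ℝ (skewAdjoint.submodule ℝ R) + finrank ℝ (skewAdjoint.submodule ℝ S) := by
  have : skewAdjoint.submodule ℝ (R × S) =
      (skewAdjoint.submodule ℝ R).prod (skewAdjoint.submodule ℝ S) := by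
    ext ⟨x, y⟩
    exact Prod.mk_inj
  rw [this, finrank_submodule_prod]

theorem finrank_skewAnticommutant_prod [FiniteDimensional ℝ R] [FiniteDimensional ℝ S]
    (g : R) (h : S) : finrank ℝ (skewAnticommutant (g, h)) =
      finrank ℝ (skewAnticommutant g) + finrank ℝ (skewAnticommutant h) := by
  have : skewAnticommutant (g, h) = (skewAnticommutant g).prod (skewAnticommutant h) := by
    ext ⟨x, y⟩
    simp only [mem_skewAnticommutant_iff, Submodule.mem_prod, Prod.star_def, Prod.mk_mul_mk,
      Prod.neg_mk, Prod.mk.injEq]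
    tauto
  rw [this, finrank_submodule_prod]

end StarAlgebra

section NormedStarAlgebra

variable {R : Type*} [NormedRing R] [StarRing R] [NormedAlgebra ℝ R]

theorem eventually_sq_eq_of_mem_projectiveInvolutions [CompleteSpace R] {h : R}
    (hh : h ∈ projectiveInvolutions R) :
    ∀ᶠ y in 𝓝 h, y ∈ projectiveInvolutions R → y ^ 2 = h ^ 2 := by
  have hunit : IsUnit (h ^ 2 + h ^ 2) := by
    rw [← two_smul ℝ]
    exact (IsUnit.of_pow_eq_one (n := 2) (by rw [← pow_mul, hh.2.2]) two_ne_zero).smul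
      (Units.mk0 (2 : ℝ) two_ne_zero)
  have hcont : Continuous fun y : R => y ^ 2 + h ^ 2 := by fun_prop
  filter_upwards [hcont.continuousAt.eventually_mem (Units.isOpen.mem_nhds hunit)] with y hy hyS
  have hprod : (y ^ 2 - h ^ 2) * (y ^ 2 + h ^ 2) = 0 := by
    have hcomm : Commute (y ^ 2) (h ^ 2) := hyS.2.1.comm _
    rw [← hcomm.mul_self_sub_mul_self_eq', ← sq, ← sq, ← pow_mul, ← pow_mul, hyS.2.2, hh.2.2,
      sub_self]
  exact sub_eq_zero.1 ((IsUnit.mul_left_eq_zero hy).1 hprod)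

variable [StarModule ℝ R]

theorem exists_mem_nhds_dimH_projectiveInvolutions_inter_le [FiniteDimensional ℝ R] {h : R}
    (hh : h ∈ projectiveInvolutions R) :
    ∃ U ∈ 𝓝 h, dimH (projectiveInvolutions R ∩ U) ≤ finrank ℝ (skewAnticommutant h) := by
  have : CompleteSpace R := FiniteDimensional.complete ℝ R
  -- On projective involutions with the same square as `h` the map `f` is the commutator with `h`;
  -- the term `y ^ 2 - h ^ 2` makes its derivative `d ↦ 2 * h * d` at `h` invertible.
  let f : R → R := fun y => (y ^ 2 - h ^ 2) + (h * y - y * h)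
  let f' : R ≃L[ℝ] R := .equivOfInverse ((2 : ℝ) • ContinuousLinearMap.mul ℝ R h)
    ((1 / 2 : ℝ) • ContinuousLinearMap.mul ℝ R (star h))
    (fun d => by simp [← mul_assoc, Unitary.star_mul_self_of_mem hh.1])
    (fun d => by simp [← mul_assoc, Unitary.mul_star_self_of_mem hh.1])
  have hf : HasStrictFDerivAt f (f' : R →L[ℝ] R) h := by
    have hid := hasStrictFDerivAt_id (𝕜 := ℝ) h
    refine (((hid.pow' 2).sub_const (h ^ 2)).add
      ((hid.const_mul h).sub (hid.mul_const' h))).congr_fderiv ?_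
    ext d
    simp [f', two_smul, Finset.sum_range_succ]
  obtain ⟨U, hU, hdim⟩ := exists_mem_nhds_forall_dimH_le_dimH_image hf
  refine ⟨_, inter_mem hU (eventually_sq_eq_of_mem_projectiveInvolutions hh), ?_⟩
  rw [← dimH_submodule]
  refine (hdim _ (inter_subset_right.trans inter_subset_left)).trans (dimH_mono ?_)
  rintro _ ⟨y, ⟨hy, -, hyh⟩, rfl⟩
  have hfy : f y = h * y - y * h := by simp only [f, hyh hy, sub_self, zero_add]
  exact hfy ▸ commutator_mem_skewAnticommutant hh hy (hyh hy)

theorem dimH_projectiveInvolutions_le [FiniteDimensional ℝ R] {k : ℕ}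
    (hk : ∀ h ∈ projectiveInvolutions R, finrank ℝ (skewAnticommutant h) ≤ k) :
    dimH (projectiveInvolutions R) ≤ k := by
  have : ProperSpace R := FiniteDimensional.proper ℝ R
  refine dimH_le_of_forall_exists_mem_nhdsWithin fun h hh => ?_
  obtain ⟨U, hU, hdim⟩ := exists_mem_nhds_dimH_projectiveInvolutions_inter_le hh
  exact ⟨_, inter_mem_nhdsWithin _ hU, hdim.trans (mod_cast hk h hh)⟩

theorem dimH_image_mul_projectiveInvolutions_le [FiniteDimensional ℝ R] {k : ℕ}
    (hk : ∀ h ∈ projectiveInvolutions R, finrank ℝ (skewAnticommutant h) ≤ k) :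
    dimH ((fun p : R × R × R => (p.1 * p.2.1, p.1 * p.2.2)) ''
      (projectiveInvolutions (R × R × R))) ≤ (3 * k : ℕ) := by
  have hF : ContDiff ℝ 1 fun p : R × R × R => (p.1 * p.2.1, p.1 * p.2.2) := by fun_prop
  refine (hF.contDiffOn.dimH_image_le convex_univ (subset_univ _)).trans
    (dimH_projectiveInvolutions_le ?_)
  rintro ⟨x, y, z⟩ hxyz
  obtain ⟨hx, hyz⟩ := mk_mem_projectiveInvolutions_iff.1 hxyz
  obtain ⟨hy, hz⟩ := mk_mem_projectiveInvolutions_iff.1 hyz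
  rw [finrank_skewAnticommutant_prod, finrank_skewAnticommutant_prod]
  linarith [hk x hx, hk y hy, hk z hz]

end NormedStarAlgebra

section NullSets

theorem measure_eq_zero_of_forall_measure_preimage_mul_right {G : Type*} [Group G]
    [MeasurableSpace G] [MeasurableMul₂ G] (μ : Measure G) [SFinite μ] [μ.IsMulLeftInvariant]
    {ν : Measure G} [SFinite ν] (hν : ν ≠ 0) {N : Set G} (hN : MeasurableSet N)
    (h : ∀ g, ν ((· * g) ⁻¹' N) = 0) : μ N = 0 := by
  have hm : MeasurableSet ((fun p : G × G => p.1 * p.2) ⁻¹' N) := measurable_mul hN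
  have hleft : (ν.prod μ) ((fun p : G × G => p.1 * p.2) ⁻¹' N) = μ N * ν univ := by
    rw [Measure.prod_apply hm, ← lintegral_const]
    exact lintegral_congr fun x => measure_preimage_mul μ x N
  have hright : (ν.prod μ) ((fun p : G × G => p.1 * p.2) ⁻¹' N) = 0 := by
    rw [Measure.prod_apply_symm hm, ← lintegral_zero (μ := μ)]
    exact lintegral_congr h
  exact (mul_eq_zero.1 (hleft.symm.trans hright)).resolve_right (Measure.measure_univ_ne_zero.2 hν)

theorem dimH_preimage_mul_right_unitary_le {R : Type*} [NormedRing R] [StarRing R]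
    (u : unitary R) (s : Set (unitary R)) : dimH ((· * u) ⁻¹' s) ≤ dimH s := by
  have hanti : AntilipschitzWith ‖star (u : R)‖₊ fun v : unitary R => v * u := by
    refine .of_le_mul_dist fun v w => ?_
    rw [Subtype.dist_eq, Subtype.dist_eq, dist_eq_norm, dist_eq_norm, coe_nnnorm]
    calc ‖(v - w : R)‖ = ‖(v * u - w * u) * star (u : R)‖ := by
          rw [← sub_mul, mul_assoc, Unitary.mul_star_self_of_mem u.2, mul_one]
      _ ≤ ‖star (u : R)‖ * ‖(v * u - w * u : R)‖ := by
          rw [mul_comm ‖star (u : R)‖]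
          exact norm_mul_le _ _
  exact hanti.dimH_preimage_le s

variable {R : Type*} [NormedRing R] [StarRing R] [NormedAlgebra ℝ R] [StarModule ℝ R]
  [ContinuousStar R] [FiniteDimensional ℝ R]

/-- The exponential map from skew-adjoint to unitary elements, which provides a chart of the
unitary group at the identity. -/
noncomputable def expSkewAdjoint (x : skewAdjoint.submodule ℝ R) : unitary R :=
  ⟨NormedSpace.exp (x : R), by
    have : CompleteSpace R := FiniteDimensional.complete ℝ R
    let +nondep : NormedAlgebra ℚ R := .restrictScalars ℚ ℝ R
    exact NormedSpace.exp_mem_unitary_of_mem_skewAdjoint x.2⟩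

theorem continuous_expSkewAdjoint : Continuous (expSkewAdjoint (R := R)) := by
  have : CompleteSpace R := FiniteDimensional.complete ℝ R
  let +nondep : NormedAlgebra ℚ R := .restrictScalars ℚ ℝ R
  exact (NormedSpace.exp_continuous.comp continuous_subtype_val).subtype_mk _

theorem exists_mem_nhds_forall_dimH_le_dimH_image_expSkewAdjoint :
    ∃ U ∈ 𝓝 (0 : skewAdjoint.submodule ℝ R), ∀ s ⊆ U, dimH s ≤ dimH (expSkewAdjoint '' s) := by
  have : CompleteSpace R := FiniteDimensional.complete ℝ R
  obtain ⟨U, hU, hdim⟩ := exists_mem_nhds_forall_dimH_le_dimH_image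
    (f' := ContinuousLinearEquiv.refl ℝ R) (hasStrictFDerivAt_exp_zero (𝕂 := ℝ) (𝔸 := R))
  refine ⟨Subtype.val ⁻¹' U, continuous_subtype_val.continuousAt.preimage_mem_nhds hU,
    fun s hs => ?_⟩
  have hcoe : Subtype.val '' (expSkewAdjoint '' s) = NormedSpace.exp '' (Subtype.val '' s) := by
    simp only [image_image, expSkewAdjoint]
  calc dimH s = dimH (Subtype.val '' s) :=
        ((skewAdjoint.submodule ℝ R).subtypeₗᵢ.isometry.dimH_image s).symm
    _ ≤ dimH (NormedSpace.exp '' (Subtype.val '' s)) := hdim _ (image_subset_iff.2 hs)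
    _ = dimH (expSkewAdjoint '' s) := by
        rw [← hcoe]
        exact isometry_subtype_coe.dimH_image _

theorem measure_eq_zero_of_dimH_preimage_lt {G : Type*} [Group G] [TopologicalSpace G]
    [MeasurableSpace G] [BorelSpace G] [MeasurableMul₂ G] (μ : Measure G) [SFinite μ]
    [μ.IsMulLeftInvariant] {π : unitary R →* G} (hπ : Continuous π)
    (hπs : Function.Surjective π) {N : Set G} (hN : MeasurableSet N)
    (hdim : dimH (π ⁻¹' N) < finrank ℝ (skewAdjoint.submodule ℝ R)) : μ N = 0 := by
  borelize ↥(skewAdjoint.submodule ℝ R)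
  obtain ⟨U, hU, hexp⟩ := exists_mem_nhds_forall_dimH_le_dimH_image_expSkewAdjoint (R := R)
  let ν : Measure (skewAdjoint.submodule ℝ R) :=
    μH[finrank ℝ (skewAdjoint.submodule ℝ R)].restrict (interior U)
  have hν : ν ≠ 0 := Measure.restrict_eq_zero.not.2
    (isOpen_interior.measure_pos _ ⟨0, mem_interior_iff_mem_nhds.2 hU⟩).ne'
  have hφ : Measurable (π ∘ expSkewAdjoint) := (hπ.comp continuous_expSkewAdjoint).measurable
  refine measure_eq_zero_of_forall_measure_preimage_mul_right μ
    (ν := ν.map (π ∘ expSkewAdjoint)) ((Measure.map_ne_zero_iff hφ.aemeasurable).2 hν) hN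
    fun g => ?_
  obtain ⟨u, rfl⟩ := hπs g
  have hpre : MeasurableSet ((· * π u) ⁻¹' N) := measurable_mul_const _ hN
  rw [Measure.map_apply hφ hpre, Measure.restrict_apply (hφ hpre)]
  refine hausdorffMeasure_of_dimH_lt (d := (finrank ℝ (skewAdjoint.submodule ℝ R) : ℝ≥0))
    (lt_of_le_of_lt ?_ (mod_cast hdim))
  refine ((hexp _ (inter_subset_right.trans interior_subset)).trans (dimH_mono ?_)).trans
    (dimH_preimage_mul_right_unitary_le u _)
  rintro _ ⟨x, ⟨hx, -⟩, rfl⟩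
  simpa only [mem_preimage, Function.comp_apply, map_mul] using hx

end NullSets

theorem measurableSet_of_isSigmaCompact {X : Type*} [TopologicalSpace X] [T2Space X]
    [MeasurableSpace X] [BorelSpace X] {s : Set X} (hs : IsSigmaCompact s) : MeasurableSet s := by
  obtain ⟨K, hK, rfl⟩ := hs
  exact MeasurableSet.iUnion fun i => (hK i).measurableSet

theorem sigmaCompactSpace_unitary (R : Type*) [NormedRing R] [StarRing R] [ContinuousStar R]
    [ProperSpace R] : SigmaCompactSpace (unitary R) := by
  have hclosed : IsClosed {x : R | star x * x = 1 ∧ x * star x = 1} :=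
    (isClosed_eq (by fun_prop) continuous_const).inter (isClosed_eq (by fun_prop) continuous_const)
  exact hclosed.sigmaCompactSpace

/-- The unitary group of a product, split into the unitary groups of the factors. -/
def unitaryProdEquiv (R S : Type*) [Ring R] [StarRing R] [Ring S] [StarRing S] :
    unitary (R × S) ≃* unitary R × unitary S where
  toFun u :=
    (⟨u.1.1, congrArg Prod.fst u.2.1, congrArg Prod.fst u.2.2⟩,
      ⟨u.1.2, congrArg Prod.snd u.2.1, congrArg Prod.snd u.2.2⟩)
  invFun p := ⟨(p.1, p.2), Prod.ext p.1.2.1 p.2.2.1, Prod.ext p.1.2.2 p.2.2.2⟩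
  map_mul' _ _ := rfl

theorem continuous_unitaryProdEquiv (R S : Type*) [Ring R] [StarRing R] [TopologicalSpace R]
    [Ring S] [StarRing S] [TopologicalSpace S] : Continuous (unitaryProdEquiv R S) :=
  ((continuous_fst.comp continuous_subtype_val).subtype_mk _).prodMk
    ((continuous_snd.comp continuous_subtype_val).subtype_mk _)

namespace QuaternionicUnitary

section StronglyDoublyReversible

theorem isStronglyDoublyReversible_iff_exists_mul {G : Type*} [Group G] {g : G × G} :
    IsStronglyDoublyReversible g ↔
      ∃ x y z : G, x ^ 2 = 1 ∧ y ^ 2 = 1 ∧ z ^ 2 = 1 ∧ g = (x * y, x * z) := by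
  have hconj : ∀ {h : G}, h ^ 2 = 1 → ∀ a, h * a * h⁻¹ = a⁻¹ ↔ (h * a) ^ 2 = 1 := by
    intro h hh a
    rw [inv_eq_of_mul_eq_one_left ((sq h).symm.trans hh), eq_inv_iff_mul_eq_one, sq, ← mul_assoc]
  constructor
  · rintro ⟨h, hh, h₁, h₂⟩
    have hmul : ∀ a, h * (h * a) = a := fun a => by rw [← mul_assoc, ← sq, hh, one_mul]
    exact ⟨h, h * g.1, h * g.2, hh, (hconj hh _).1 h₁, (hconj hh _).1 h₂,
      Prod.ext (hmul _).symm (hmul _).symm⟩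
  · rintro ⟨x, y, z, hx, hy, hz, rfl⟩
    have hmul : ∀ a, x * (x * a) = a := fun a => by rw [← mul_assoc, ← sq, hx, one_mul]
    exact ⟨x, hx, (hconj hx _).2 (by rwa [hmul]), (hconj hx _).2 (by rwa [hmul])⟩

theorem measurableSet_isStronglyDoublyReversible {G : Type*} [Group G] [TopologicalSpace G]
    [IsTopologicalGroup G] [T2Space G] [SigmaCompactSpace G] [MeasurableSpace (G × G)]
    [BorelSpace (G × G)] : MeasurableSet {g : G × G | IsStronglyDoublyReversible g} := by
  have hclosed : IsClosed {p : G × (G × G) | p.1 ^ 2 = 1 ∧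
      p.1 * p.2.1 * p.1⁻¹ = p.2.1⁻¹ ∧ p.1 * p.2.2 * p.1⁻¹ = p.2.2⁻¹} :=
    (isClosed_eq (by fun_prop) (by fun_prop)).inter
      ((isClosed_eq (by fun_prop) (by fun_prop)).inter (isClosed_eq (by fun_prop) (by fun_prop)))
  have hproj : {g : G × G | IsStronglyDoublyReversible g} = Prod.snd '' {p : G × (G × G) |
      p.1 ^ 2 = 1 ∧ p.1 * p.2.1 * p.1⁻¹ = p.2.1⁻¹ ∧ p.1 * p.2.2 * p.1⁻¹ = p.2.2⁻¹} := by
    ext g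
    simp only [IsStronglyDoublyReversible, mem_ofPred_eq, mem_image, Prod.exists,
      exists_eq_right]
  rw [hproj]
  exact measurableSet_of_isSigmaCompact
    ((isSigmaCompact_univ.of_isClosed_subset hclosed (subset_univ _)).image continuous_snd)

variable {R G : Type*} [Group G]

theorem coe_mem_projectiveInvolutions [Ring R] [StarRing R] {π : unitary R →* G}
    (hker : ∀ u, π u = 1 → (u : R) ∈ center R ∧ u ^ 2 = 1) {u : unitary R} (hu : π u ^ 2 = 1) :
    (u : R) ∈ projectiveInvolutions R := by
  obtain ⟨hcenter, hsq⟩ := hker (u ^ 2) (by rw [map_pow, hu])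
  refine ⟨u.2, by exact_mod_cast hcenter, ?_⟩
  rw [← pow_mul] at hsq
  exact congrArg Subtype.val hsq

theorem mem_image_mul_of_isStronglyDoublyReversible [Ring R] [StarRing R] {π : unitary R →* G}
    (hπs : Function.Surjective π) (hker : ∀ u, π u = 1 → (u : R) ∈ center R ∧ u ^ 2 = 1)
    {u v : unitary R} (h : IsStronglyDoublyReversible (π u, π v)) :
    ((u, v) : R × R) ∈ (fun p : R × R × R => (p.1 * p.2.1, p.1 * p.2.2)) ''
      projectiveInvolutions (R × R × R) := by
  obtain ⟨x, y, z, hx, hy, hz, hxyz⟩ := isStronglyDoublyReversible_iff_exists_mul.1 h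
  obtain ⟨hxy, hxz⟩ := Prod.mk.inj hxyz
  obtain ⟨ξ, rfl⟩ := hπs x
  have hlift : ∀ w : unitary R, (ξ : R) * (ξ⁻¹ * w : unitary R) = w := fun w =>
    congrArg Subtype.val (mul_inv_cancel_left ξ w)
  refine ⟨(ξ, (ξ⁻¹ * u : unitary R), (ξ⁻¹ * v : unitary R)),
    mk_mem_projectiveInvolutions_iff.2 ⟨coe_mem_projectiveInvolutions hker hx,
      mk_mem_projectiveInvolutions_iff.2 ⟨coe_mem_projectiveInvolutions hker ?_,
        coe_mem_projectiveInvolutions hker ?_⟩⟩, Prod.ext (hlift u) (hlift v)⟩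
  · rwa [map_mul, map_inv, hxy, inv_mul_cancel_left]
  · rwa [map_mul, map_inv, hxz, inv_mul_cancel_left]

theorem measure_isStronglyDoublyReversible_eq_zero [NormedRing R] [StarRing R] [NormedAlgebra ℝ R]
    [StarModule ℝ R] [ContinuousStar R] [FiniteDimensional ℝ R] [TopologicalSpace G]
    [IsTopologicalGroup G] [T2Space G] [SecondCountableTopology G] [MeasurableSpace G]
    [BorelSpace G] {π : unitary R →* G} (hπ : Continuous π) (hπs : Function.Surjective π)
    (hker : ∀ u, π u = 1 → (u : R) ∈ center R ∧ u ^ 2 = 1) {k : ℕ}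
    (hk : ∀ h ∈ projectiveInvolutions R, finrank ℝ (skewAnticommutant h) ≤ k)
    (hlt : 3 * k < 2 * finrank ℝ (skewAdjoint.submodule ℝ R)) (μ : Measure (G × G))
    [IsFiniteMeasureOnCompacts μ] [μ.IsMulLeftInvariant] :
    μ {g | IsStronglyDoublyReversible g} = 0 := by
  have : ProperSpace R := FiniteDimensional.proper ℝ R
  have : SigmaCompactSpace (unitary R) := sigmaCompactSpace_unitary R
  have : SigmaCompactSpace G :=
    ⟨hπs.range_eq ▸ image_univ (f := π) ▸ isSigmaCompact_univ.image hπ⟩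
  let π₂ : unitary (R × R) →* G × G := (π.prodMap π).comp (unitaryProdEquiv R R).toMonoidHom
  have hπ₂ : Continuous π₂ := (hπ.prodMap hπ).comp (continuous_unitaryProdEquiv R R)
  have hπ₂s : Function.Surjective π₂ := (hπs.prodMap hπs).comp (unitaryProdEquiv R R).surjective
  have hsub : Subtype.val '' (π₂ ⁻¹' {g | IsStronglyDoublyReversible g}) ⊆
      (fun p : R × R × R => (p.1 * p.2.1, p.1 * p.2.2)) '' projectiveInvolutions (R × R × R) :=
    image_subset_iff.2 fun _ hu => mem_image_mul_of_isStronglyDoublyReversible hπs hker hu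
  refine measure_eq_zero_of_dimH_preimage_lt μ hπ₂ hπ₂s
    measurableSet_isStronglyDoublyReversible ?_
  calc dimH (π₂ ⁻¹' {g | IsStronglyDoublyReversible g})
      = dimH (Subtype.val '' (π₂ ⁻¹' {g | IsStronglyDoublyReversible g})) :=
        (isometry_subtype_coe.dimH_image _).symm
    _ ≤ (3 * k : ℕ) := (dimH_mono hsub).trans (dimH_image_mul_projectiveInvolutions_le hk)
    _ < finrank ℝ (skewAdjoint.submodule ℝ (R × R)) := by
        rw [finrank_skewAdjoint_prod, ← two_mul]
        exact_mod_cast hlt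

end StronglyDoublyReversible

end QuaternionicUnitary

section Trace

theorem trace_matrix_eq_sum {K n E : Type*} [CommRing K] [Fintype n] [DecidableEq n]
    [AddCommGroup E] [Module K E] [Module.Free K E] [Module.Finite K E]
    (f : Matrix n n E →ₗ[K] Matrix n n E) :
    LinearMap.trace K _ f = ∑ i, ∑ j, LinearMap.trace K E
      (Matrix.entryLinearMap K E i j ∘ₗ f ∘ₗ Matrix.singleLinearMap K i j) := by
  have hf : f = ∑ i, ∑ j, (f ∘ₗ Matrix.singleLinearMap K i j) ∘ₗ
      Matrix.entryLinearMap K E i j := by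
    ext X : 1
    conv_lhs => rw [Matrix.matrix_eq_sum_single X]
    simp [LinearMap.sum_apply]
  conv_lhs => rw [hf]
  simp only [map_sum]
  exact Finset.sum_congr rfl fun i _ => Finset.sum_congr rfl fun j _ =>
    LinearMap.trace_comp_comm' _ _

theorem trace_quaternionAlgebra {K : Type*} [CommRing K] {c₁ c₂ c₃ : K}
    (f : ℍ[K,c₁,c₂,c₃] →ₗ[K] ℍ[K,c₁,c₂,c₃]) :
    LinearMap.trace K _ f = (f ⟨1, 0, 0, 0⟩).re + (f ⟨0, 1, 0, 0⟩).imI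
      + (f ⟨0, 0, 1, 0⟩).imJ + (f ⟨0, 0, 0, 1⟩).imK := by
  have hbasis (i : Fin 4) : QuaternionAlgebra.basisOneIJK c₁ c₂ c₃ i =
      ![⟨1, 0, 0, 0⟩, ⟨0, 1, 0, 0⟩, ⟨0, 0, 1, 0⟩, ⟨0, 0, 0, 1⟩] i := by
    apply (QuaternionAlgebra.basisOneIJK c₁ c₂ c₃).repr.injective
    ext j
    rw [Basis.repr_self, QuaternionAlgebra.coe_basisOneIJK_repr]
    fin_cases i <;> fin_cases j <;> simp
  simp [LinearMap.trace_eq_matrix_trace K (QuaternionAlgebra.basisOneIJK c₁ c₂ c₃), Matrix.trace,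
    Fin.sum_univ_four, LinearMap.toMatrix_apply, hbasis, QuaternionAlgebra.coe_basisOneIJK_repr]

theorem trace_quaternion_mul_mul {K : Type*} [CommRing K] {a b : ℍ[K,-1,0,-1]}
    {f : ℍ[K,-1,0,-1] →ₗ[K] ℍ[K,-1,0,-1]} (hf : ∀ x, f x = a * x * b) :
    LinearMap.trace K _ f = 4 * (a.re * b.re) := by
  simp only [trace_quaternionAlgebra, hf, QuaternionAlgebra.re_mul, QuaternionAlgebra.imI_mul,
    QuaternionAlgebra.imJ_mul, QuaternionAlgebra.imK_mul]
  ring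

theorem trace_quaternion_mul_star_mul {K : Type*} [CommRing K] {a b : ℍ[K,-1,0,-1]}
    {f : ℍ[K,-1,0,-1] →ₗ[K] ℍ[K,-1,0,-1]} (hf : ∀ x, f x = a * star x * b) :
    LinearMap.trace K _ f = -2 * (a * star b).re := by
  simp only [trace_quaternionAlgebra, hf, QuaternionAlgebra.re_mul, QuaternionAlgebra.imI_mul,
    QuaternionAlgebra.imJ_mul, QuaternionAlgebra.imK_mul, QuaternionAlgebra.re_star,
    QuaternionAlgebra.imI_star, QuaternionAlgebra.imJ_star, QuaternionAlgebra.imK_star]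
  ring

end Trace

section Projections

variable {R : Type*} [Ring R] [StarRing R] [Algebra ℝ R] [StarModule ℝ R]

/-- The linear map `x ↦ a * star x * b`; it is the counterpart of `LinearMap.mulLeftRight`
needed to write down the projections onto spaces of skew-adjoint elements. -/
def starMulLeftRight (a b : R) : R →ₗ[ℝ] R :=
  LinearMap.mulLeftRight ℝ (a, b) ∘ₗ (starLinearEquiv ℝ : R ≃ₗ⋆[ℝ] R).toLinearMap

@[simp]
theorem starMulLeftRight_apply (a b x : R) : starMulLeftRight a b x = a * star x * b := rfl

theorem isProj_skewAdjoint :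
    LinearMap.IsProj (skewAdjoint.submodule ℝ R)
      ((1 / 2 : ℝ) • (LinearMap.id - starMulLeftRight (1 : R) 1)) where
  map_mem x := by
    have hskew : x - star x ∈ skewAdjoint.submodule ℝ R := by
      change star (x - star x) = -(x - star x)
      rw [star_sub, star_star, neg_sub]
    simpa using Submodule.smul_mem _ (1 / 2 : ℝ) hskew
  map_id x hx := by
    have hstar : star x = -x := hx
    simp [hstar, ← two_smul ℝ x]

theorem isProj_skewAnticommutant {h : R} (hh : h ∈ projectiveInvolutions R) :
    LinearMap.IsProj (skewAnticommutant h)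
      ((1 / 4 : ℝ) • (LinearMap.id - starMulLeftRight (1 : R) 1
        - LinearMap.mulLeftRight ℝ (h, star h) + starMulLeftRight h (star h))) where
  map_mem x := by
    have hleft (y : R) : h * (h * y * star h) = y * h :=
      calc h * (h * y * star h) = h ^ 2 * y * star h := by noncomm_ring
        _ = y * h ^ 2 * star h := by rw [hh.2.1.comm]
        _ = y * h := by
          rw [sq, mul_assoc, mul_assoc, Unitary.mul_star_self_of_mem hh.1, mul_one]
    have hright (y : R) : h * y * star h * h = h * y := by
      rw [mul_assoc _ (star h), Unitary.star_mul_self_of_mem hh.1, mul_one]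
    have hmem : x - star x - h * x * star h + h * star x * star h ∈ skewAnticommutant h := by
      refine mem_skewAnticommutant_iff.2 ⟨?_, ?_⟩
      · simp only [star_add, star_sub, star_mul, star_star, ← mul_assoc]
        abel
      · simp only [mul_add, mul_sub, add_mul, sub_mul, hleft, hright]
        abel
    simpa using Submodule.smul_mem _ (1 / 4 : ℝ) hmem
  map_id x hx := by
    obtain ⟨hstar, hanti⟩ := mem_skewAnticommutant_iff.1 hx
    have hconj : h * x * star h = -x := by
      rw [hanti, neg_mul, mul_assoc, Unitary.mul_star_self_of_mem hh.1, mul_one]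
    simp only [LinearMap.add_apply, LinearMap.smul_apply, LinearMap.sub_apply, LinearMap.id_apply,
      LinearMap.mulLeftRight_apply, starMulLeftRight_apply, hstar, one_mul, mul_one, mul_neg,
      neg_mul, hconj]
    module

end Projections

namespace QuaternionicUnitary

instance : StarModule ℝ ℍ := ⟨fun r q => (Quaternion.star_smul r q).trans (by rw [star_trivial r])⟩

section QuaternionicMatrices

variable {ι : Type*} [Fintype ι]

theorem re_trace (A : Matrix ι ι ℍ) : A.trace.re = ∑ i, (A i i).re :=
  map_sum (QuaternionAlgebra.reₗ (R := ℝ) (-1) 0 (-1)) (fun i => A i i) Finset.univ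

theorem re_trace_mul_star (A B : Matrix ι ι ℍ) :
    (A * star B).trace.re = ∑ i, ∑ j, (A i j * star (B i j)).re := by
  rw [re_trace]
  exact Finset.sum_congr rfl fun i _ =>
    map_sum (QuaternionAlgebra.reₗ (R := ℝ) (-1) 0 (-1)) (fun j => A i j * star (B i j)) Finset.univ

theorem re_trace_star (A : Matrix ι ι ℍ) : (star A).trace.re = A.trace.re := by
  rw [Matrix.star_eq_conjTranspose, Matrix.trace_conjTranspose, Quaternion.re_star]

theorem re_trace_mul_star_self_nonneg (A : Matrix ι ι ℍ) : 0 ≤ (A * star A).trace.re := by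
  rw [re_trace_mul_star]
  exact Finset.sum_nonneg fun i _ => Finset.sum_nonneg fun j _ => Quaternion.normSq_nonneg

theorem trace_id_matrix : LinearMap.trace ℝ (Matrix ι ι ℍ) LinearMap.id =
    4 * (Fintype.card ι : ℝ) ^ 2 := by
  rw [LinearMap.trace_id, finrank_matrix, Quaternion.finrank_eq_four]
  push_cast
  ring

theorem trace_mulLeftRight (A B : Matrix ι ι ℍ) :
    LinearMap.trace ℝ _ (LinearMap.mulLeftRight ℝ (A, B)) = 4 * (A.trace.re * B.trace.re) := by
  classical
  have hentry (i j : ι) : LinearMap.trace ℝ ℍ (Matrix.entryLinearMap ℝ ℍ i j ∘ₗ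
      LinearMap.mulLeftRight ℝ (A, B) ∘ₗ Matrix.singleLinearMap ℝ i j) =
        4 * ((A i i).re * (B j j).re) := by
    have happly (x : ℍ) : (Matrix.entryLinearMap ℝ ℍ i j ∘ₗ LinearMap.mulLeftRight ℝ (A, B) ∘ₗ
        Matrix.singleLinearMap ℝ i j) x = A i i * x * B j j := by
      simp [Matrix.mul_apply, Matrix.single_apply, ite_and]
    exact trace_quaternion_mul_mul happly
  simp only [trace_matrix_eq_sum, hentry, ← Finset.mul_sum, ← Finset.sum_mul, re_trace]

variable [DecidableEq ι]

theorem re_trace_one : (1 : Matrix ι ι ℍ).trace.re = Fintype.card ι := by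
  rw [Matrix.trace_one, Quaternion.re_natCast]

theorem neg_card_le_re_trace_mul_self {A : Matrix ι ι ℍ} (hA : A ∈ unitary (Matrix ι ι ℍ)) :
    -(Fintype.card ι : ℝ) ≤ (A * A).trace.re := by
  have hexpand : (A + star A) * star (A + star A) = A * A + star (A * A) + 1 + 1 := by
    rw [star_add, star_star, star_mul, add_mul, mul_add, mul_add, Unitary.mul_star_self_of_mem hA,
      Unitary.star_mul_self_of_mem hA]
    abel
  have hnonneg := re_trace_mul_star_self_nonneg (A + star A)
  rw [hexpand, Matrix.trace_add, Matrix.trace_add, Matrix.trace_add, Quaternion.re_add,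
    Quaternion.re_add, Quaternion.re_add, re_trace_star, re_trace_one] at hnonneg
  linarith

theorem trace_starMulLeftRight (A B : Matrix ι ι ℍ) :
    LinearMap.trace ℝ _ (starMulLeftRight A B) = -2 * (A * star B).trace.re := by
  have hentry (i j : ι) : LinearMap.trace ℝ ℍ (Matrix.entryLinearMap ℝ ℍ i j ∘ₗ
      starMulLeftRight A B ∘ₗ Matrix.singleLinearMap ℝ i j) = -2 * (A i j * star (B i j)).re := by
    have happly (x : ℍ) : (Matrix.entryLinearMap ℝ ℍ i j ∘ₗ starMulLeftRight A B ∘ₗ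
        Matrix.singleLinearMap ℝ i j) x = A i j * star x * B i j := by
      simp [Matrix.mul_apply, Matrix.single_apply, ite_and, apply_ite star]
    exact trace_quaternion_mul_star_mul happly
  simp only [trace_matrix_eq_sum, hentry, ← Finset.mul_sum, re_trace_mul_star]

omit [DecidableEq ι] in
theorem finrank_skewAdjoint_matrix :
    finrank ℝ (skewAdjoint.submodule ℝ (Matrix ι ι ℍ)) =
      Fintype.card ι * (2 * Fintype.card ι + 1) := by
  classical
  have htrace := (isProj_skewAdjoint (R := Matrix ι ι ℍ)).trace
  rw [map_smul, map_sub, trace_id_matrix, trace_starMulLeftRight, star_one, mul_one,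
    re_trace_one] at htrace
  rify
  rw [← htrace, smul_eq_mul]
  ring

theorem finrank_skewAnticommutant_matrix_le {h : Matrix ι ι ℍ}
    (hh : h ∈ projectiveInvolutions (Matrix ι ι ℍ)) :
    finrank ℝ (skewAnticommutant h) ≤ Fintype.card ι * (Fintype.card ι + 1) := by
  have htrace := (isProj_skewAnticommutant hh).trace
  rw [map_smul, map_add, map_sub, map_sub, trace_id_matrix, trace_starMulLeftRight,
    trace_starMulLeftRight, trace_mulLeftRight, star_one, mul_one, star_star, re_trace_one,
    re_trace_star, smul_eq_mul] at htrace
  rify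
  linarith [neg_card_le_re_trace_mul_self hh.1, mul_self_nonneg h.trace.re]

end QuaternionicMatrices

end QuaternionicUnitary

attribute [local instance] Matrix.linftyOpNormedRing Matrix.linftyOpNormedAlgebra

namespace QuaternionicUnitary

variable {n : ℕ}

instance : @ContinuousStar (Matrix (Fin n) (Fin n) ℍ)
    PseudoMetricSpace.toUniformSpace.toTopologicalSpace _ :=
  ⟨continuous_id.matrix_conjTranspose⟩

/-- The projection `Sp(n) → PSp(n)`. -/
noncomputable def toPSp (n : ℕ) : Sp n →* PSp n := QuotientGroup.mk' (plusMinusOne n)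

theorem toPSp_surjective : Function.Surjective (toPSp n) :=
  QuotientGroup.mk'_surjective _

theorem continuous_toPSp : Continuous (toPSp n) :=
  (QuotientGroup.continuous_mk : Continuous (QuotientGroup.mk : Sp n → Sp n ⧸ plusMinusOne n))

theorem mem_center_and_sq_eq_one_of_toPSp_eq_one {u : Sp n} (hu : toPSp n u = 1) :
    (u : Matrix (Fin n) (Fin n) ℍ) ∈ center (Matrix (Fin n) (Fin n) ℍ) ∧ u ^ 2 = 1 := by
  rcases (QuotientGroup.eq_one_iff u).1 hu with rfl | rfl
  · exact ⟨one_mem_center, one_pow 2⟩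
  · exact ⟨neg_mem_center one_mem_center, by simp⟩

instance : T2Space (PSp n) := by
  have : IsClosed (plusMinusOne n : Set (Sp n)) :=
    (Set.toFinite {1, -1}).isClosed
  exact inferInstanceAs (T2Space (Sp n ⧸ plusMinusOne n))

end QuaternionicUnitary

open QuaternionicUnitary

theorem corollary1p2 (n : ℕ) (hn : 2 ≤ n)
    (μ : MeasureTheory.Measure (QuaternionicUnitary.PSp n × QuaternionicUnitary.PSp n))
    [μ.IsHaarMeasure] :
    μ {g : QuaternionicUnitary.PSp n × QuaternionicUnitary.PSp n |
      QuaternionicUnitary.IsStronglyDoublyReversible g} = 0 := by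
  have hlt : 3 * (n * (n + 1)) <
      2 * finrank ℝ (skewAdjoint.submodule ℝ (Matrix (Fin n) (Fin n) ℍ)) := by
    rw [finrank_skewAdjoint_matrix, Fintype.card_fin]
    nlinarith
  have hle : ∀ h ∈ projectiveInvolutions (Matrix (Fin n) (Fin n) ℍ),
      finrank ℝ (skewAnticommutant h) ≤ n * (n + 1) := fun h hh => by
    simpa only [Fintype.card_fin] using finrank_skewAnticommutant_matrix_le hh
  exact measure_isStronglyDoublyReversible_eq_zero continuous_toPSp toPSp_surjective
    (fun _ => mem_center_and_sq_eq_one_of_toPSp_eq_one) hle hlt μ
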